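/- For $a,q\in\mathbb C$ with $|q|<1$ write $(a;q)_\infty=\prod_{k\ge 0}(1-aq^k)$. Let $0<|q|<1$, choose $\tau\in\mathbb C$ with $q=e^{2\pi i\tau}$, and interpret every fractional power of $q$ as $q^r=e^{2\pi i r\tau}$. Define the septic theta functions \[ a(q)=-\sum_{n=-\infty}^{\infty}(-1)^n q^{(14n+5)^2/56},\qquad b(q)=\sum_{n=-\infty}^{\infty}(-1)^n q^{(14n+3)^2/56},\qquad c(q)=\sum_{n=-\infty}^{\infty}(-1)^n q^{(14n+1)^2/56}, \] and the quotients \[ x=q^{7/8}(q^7;q^7)_\infty^3\,\frac{b(q)}{c(q)^2},\qquad y=-q^{7/8}(q^7;q^7)_\infty^3\,\frac{a(q)}{b(q)^2},\qquad z=q^{7/8}(q^7;q^7)_\infty^3\,\frac{c(q)}{a(q)^2}. \] Then $a(q)$, $b(q)$, $c(q)$, $(q;q)_\infty$, $(q^7;q^7)_\infty$, $y$ and $z$ are nonzero (so that all quotients here are well defined), and \begin{align*} \frac{(q;q)_\infty^4}{q\,(q^7;q^7)_\infty^4}&=\frac{z^2-xz-y^2-6yz}{yz},\\ q^2\,\frac{(q^7;q^7)_\infty^7}{(q;q)_\infty}&=xyz,\\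 q\,(q;q)_\infty^3(q^7;q^7)_\infty^3&=x\left(z^2-y^2+6xy-7xz\right),\\ \frac{(q;q)_\infty^7}{(q^7;q^7)_\infty}&=x^3-32x^2y+13xy^2-y^3+45x^2z-13xz^2+z^3. \end{align*} -/

import Mathlib

open Complex Filter Topology

namespace Septic

noncomputable section

/-- The nome `q = exp (2 π i τ)`. -/
def nome (τ : ℂ) : ℂ := cexp (2 * Real.pi * I * τ)

/-- The fractional power `q ^ r = exp (2 π i r τ)` of the nome `q = exp (2 π i τ)`; choosing `τ`
amounts to choosing a logarithm of `q`, used for all fractional powers simultaneously. -/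
def qPow (τ : ℂ) (r : ℚ) : ℂ := cexp (2 * Real.pi * I * (r : ℂ) * τ)

/-- `(a; q)_n = ∏_{k = 0}^{n - 1} (1 - a q ^ k)`. -/
def qPoch (a q : ℂ) (n : ℕ) : ℂ := ∏ k ∈ Finset.range n, (1 - a * q ^ k)

/-- `(a; q)_∞ = ∏_{k ≥ 0} (1 - a q ^ k)`. -/
def qPochInf (a q : ℂ) : ℂ := ∏' k : ℕ, (1 - a * q ^ k)

/-- For `|q| < 1` the infinite product converges, to the limit of the finite ones. -/
theorem tendsto_qPoch (a : ℂ) {q : ℂ} (hq : ‖q‖ < 1) :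
    Tendsto (qPoch a q) atTop (𝓝 (qPochInf a q)) := by
  have hm : Multipliable fun k : ℕ => 1 - a * q ^ k := by
    have h : Multipliable fun k : ℕ => 1 + -(a * q ^ k) := by
      apply multipliable_one_add_of_summable
      simpa using (summable_geometric_of_lt_one (norm_nonneg _) hq).mul_left ‖a‖
    simpa [sub_eq_add_neg] using h
  exact hm.hasProd.tendsto_prod_nat

/-- The bilateral theta series `∑_{n ∈ ℤ} (-1) ^ n q ^ ((14 n + k) ^ 2 / 56)`. -/
def thetaSeries (k : ℤ) (τ : ℂ) : ℂ :=
  ∑' n : ℤ, (-1 : ℂ) ^ n * qPow τ (((14 * n + k : ℤ) : ℚ) ^ 2 / 56)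

/-- The theta series converges (absolutely) on the upper half plane. -/
theorem summable_thetaSeries (k : ℤ) {τ : ℂ} (hτ : 0 < τ.im) :
    Summable fun n : ℤ => (-1 : ℂ) ^ n * qPow τ (((14 * n + k : ℤ) : ℚ) ^ 2 / 56) := by
  have h7 : 0 < (7 * τ).im := by simpa using hτ
  have hs := ((summable_jacobiTheta₂_term_iff ((k : ℂ) * τ / 2 + 1 / 2) (7 * τ)).2 h7).mul_left
    (cexp (2 * Real.pi * I * ((k : ℂ) ^ 2 / 56) * τ))
  refine hs.congr fun n => ?_
  have h1 : (-1 : ℂ) ^ n = cexp ((n : ℂ) * (Real.pi * I)) := by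
    rw [Complex.exp_int_mul, Complex.exp_pi_mul_I]
  rw [h1, jacobiTheta₂_term, qPow, ← Complex.exp_add, ← Complex.exp_add]
  congr 1
  push_cast
  ring

/-- `a(q) = - ∑ (-1) ^ n q ^ ((14 n + 5) ^ 2 / 56)`. -/
def thetaA (τ : ℂ) : ℂ := -thetaSeries 5 τ

/-- `b(q) = ∑ (-1) ^ n q ^ ((14 n + 3) ^ 2 / 56)`. -/
def thetaB (τ : ℂ) : ℂ := thetaSeries 3 τ

/-- `c(q) = ∑ (-1) ^ n q ^ ((14 n + 1) ^ 2 / 56)`. -/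
def thetaC (τ : ℂ) : ℂ := thetaSeries 1 τ

/-- `x(q) = q ^ (7 / 8) (q ^ 7; q ^ 7)_∞ ^ 3 b(q) / c(q) ^ 2`. -/
def x (τ : ℂ) : ℂ :=
  qPow τ (7 / 8) * qPochInf (nome τ ^ 7) (nome τ ^ 7) ^ 3 * (thetaB τ / thetaC τ ^ 2)

/-- `y(q) = - q ^ (7 / 8) (q ^ 7; q ^ 7)_∞ ^ 3 a(q) / b(q) ^ 2`. -/
def y (τ : ℂ) : ℂ :=
  -(qPow τ (7 / 8)) * qPochInf (nome τ ^ 7) (nome τ ^ 7) ^ 3 * (thetaA τ / thetaB τ ^ 2)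

/-- `z(q) = q ^ (7 / 8) (q ^ 7; q ^ 7)_∞ ^ 3 c(q) / a(q) ^ 2`. -/
def z (τ : ℂ) : ℂ :=
  qPow τ (7 / 8) * qPochInf (nome τ ^ 7) (nome τ ^ 7) ^ 3 * (thetaC τ / thetaA τ ^ 2)

end

end Septic

/-!
Consider the complex torus of period ratio `7 τ`, with a point `P` of order seven, and scale and
translate its Weierstrass equation so that `P` is the origin and the tangent at `P` is horizontal;
this is the curve `Y ^ 2 + (x + y + z) X Y + x z ^ 2 Y = X ^ 3 + y z X ^ 2`. The values of `θ₁` at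
the multiples of `P` are, up to sign, `a(q)`, `b(q)` and `c(q)`. Hence the formula for `℘(v) - ℘(u)`
in terms of `θ₁(u + v) θ₁(u - v)` shows that `y z`, `x z` and `x y` are the differences of the
values of `℘` at `P`, `2 P` and `3 P`, whence the conic `x y - x z + y z = 0`.

The duplication formula for `θ₁` gives the values of `4 (℘ - e₁) (℘ - e₂) (℘ - e₃)` at these three
points, and this identifies the roots of the two-torsion polynomial of the curve. The discriminant
is thus a product of theta constants, namely `η(7 τ) ^ 24`, while the coefficients of the curve show
that it is `x ^ 4 y ^ 3 z ^ 3 (z ^ 2 - x z - y ^ 2 - 6 y z)`. The Jacobi triple product expresses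
`a(q) b(q) c(q)`, and so `x y z`, by infinite products, which is the second identity. The first
follows on dividing the discriminant by `(x y z) ^ 4`, and modulo the conic these two imply the
others.
-/

namespace Septic

noncomputable section

open scoped ModularForm

/-! ### The Jacobi triple product -/

theorem norm_pow_lt_one {𝕜 : Type*} [NormedDivisionRing 𝕜] {q : 𝕜} (hq : ‖q‖ < 1) {n : ℕ}
    (hn : n ≠ 0) : ‖q ^ n‖ < 1 := by
  simpa only [norm_pow] using pow_lt_one₀ (norm_nonneg q) hq hn

theorem one_sub_pow_ne_zero {𝕜 : Type*} [NormedDivisionRing 𝕜] {q : 𝕜} (hq : ‖q‖ < 1) {n : ℕ}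
    (hn : n ≠ 0) : 1 - q ^ n ≠ 0 := by
  intro h
  have h1 := norm_pow_lt_one hq hn
  rw [← sub_eq_zero.1 h, norm_one] at h1
  exact lt_irrefl _ h1

theorem qPoch_succ (a q : ℂ) (n : ℕ) : qPoch a q (n + 1) = qPoch a q n * (1 - a * q ^ n) :=
  Finset.prod_range_succ _ _

theorem qPoch_mul_index (a q : ℂ) (m n : ℕ) :
    qPoch a q (m * n) = ∏ j ∈ Finset.range m, qPoch (a * q ^ j) (q ^ m) n := by
  induction n with
  | zero => simp [qPoch]
  | succ n ih =>
    simp only [qPoch_succ, Finset.prod_mul_distrib, ← ih]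
    rw [Nat.mul_succ, qPoch, Finset.prod_range_add, qPoch]
    congr 1
    refine Finset.prod_congr rfl fun j _ => ?_
    rw [pow_add, pow_mul]
    ring

theorem qPochInf_self_ne_zero {q : ℂ} (hq : ‖q‖ < 1) : qPochInf q q ≠ 0 := by
  have hs : Summable fun k : ℕ => ‖-(q * q ^ k)‖ := by
    simpa using (summable_geometric_of_lt_one (norm_nonneg _) hq).mul_left ‖q‖
  have h := tprod_one_add_ne_zero_of_summable (f := fun k : ℕ => -(q * q ^ k)) (fun k => by
    simpa only [← sub_eq_add_neg, ← pow_succ'] using one_sub_pow_ne_zero hq k.succ_ne_zero) hs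
  simpa only [qPochInf, sub_eq_add_neg] using h

theorem qPochInf_eq_prod_residues (a : ℂ) {q : ℂ} (hq : ‖q‖ < 1) {m : ℕ} (hm : m ≠ 0) :
    qPochInf a q = ∏ j ∈ Finset.range m, qPochInf (a * q ^ j) (q ^ m) := by
  have h1 : Tendsto (fun n => qPoch a q (m * n)) atTop (𝓝 (qPochInf a q)) :=
    (tendsto_qPoch a hq).comp (tendsto_id.const_mul_atTop' (Nat.pos_of_ne_zero hm))
  refine tendsto_nhds_unique h1 ?_
  simp only [qPoch_mul_index]
  exact tendsto_finsetProd _ fun j _ => tendsto_qPoch _ (norm_pow_lt_one hq hm)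

theorem qPochInf_mul_qPochInf_neg (a : ℂ) {q : ℂ} (hq : ‖q‖ < 1) :
    qPochInf a q * qPochInf (-a) q = qPochInf (a ^ 2) (q ^ 2) := by
  refine tendsto_nhds_unique ((tendsto_qPoch a hq).mul (tendsto_qPoch (-a) hq)) ?_
  refine (tendsto_qPoch (a ^ 2) (norm_pow_lt_one hq two_ne_zero)).congr fun n => ?_
  rw [qPoch, qPoch, qPoch, ← Finset.prod_mul_distrib]
  refine Finset.prod_congr rfl fun k _ => ?_
  ring

theorem qPochInf_eq_one_sub_mul (a : ℂ) {q : ℂ} (hq : ‖q‖ < 1) :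
    qPochInf a q = (1 - a) * qPochInf (a * q) q := by
  have h1 := (tendsto_qPoch a hq).comp (tendsto_add_atTop_nat 1)
  refine tendsto_nhds_unique h1 (((tendsto_qPoch (a * q) hq).const_mul (1 - a)).congr fun n => ?_)
  rw [Function.comp_apply, qPoch, qPoch, Finset.prod_range_succ', pow_zero, mul_one, mul_comm]
  congr 1
  refine Finset.prod_congr rfl fun k _ => ?_
  ring

theorem qPochInf_eq_mul_sq (a : ℂ) {q : ℂ} (hq : ‖q‖ < 1) :
    qPochInf a q = qPochInf a (q ^ 2) * qPochInf (a * q) (q ^ 2) := by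
  rw [qPochInf_eq_prod_residues a hq two_ne_zero, Finset.prod_range_succ, Finset.prod_range_one,
    pow_zero, mul_one, pow_one]

theorem qPochInf_neg_mul_qPochInf_sq {q : ℂ} (hq : ‖q‖ < 1) :
    qPochInf (-q) q * qPochInf q (q ^ 2) = 1 := by
  have h1 := qPochInf_mul_qPochInf_neg q hq
  have h2 := qPochInf_eq_mul_sq q hq
  rw [← pow_two] at h2
  refine mul_right_cancel₀ (qPochInf_self_ne_zero (norm_pow_lt_one hq two_ne_zero)) ?_
  linear_combination h1 - qPochInf (-q) q * h2

theorem qPochInf_sq_eq_mul (a : ℂ) {h : ℂ} (hh : ‖h‖ < 1) :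
    qPochInf (a ^ 2) (h ^ 2) = qPochInf a (h ^ 2) * qPochInf (-a) (h ^ 2) *
      (qPochInf (a * h) (h ^ 2) * qPochInf (-(a * h)) (h ^ 2)) := by
  have hh2 := norm_pow_lt_one hh two_ne_zero
  rw [qPochInf_mul_qPochInf_neg _ hh2, qPochInf_mul_qPochInf_neg _ hh2, mul_pow,
    ← qPochInf_eq_mul_sq _ hh2]

/-- The reciprocal of `(q; q)_n`, extended by zero to negative `n`, so that sums over binomial
coefficients can run over all of `ℤ`. -/
def invQPoch (q : ℂ) (n : ℤ) : ℂ := if 0 ≤ n then (qPoch q q n.toNat)⁻¹ else 0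

theorem invQPoch_of_neg (q : ℂ) {n : ℤ} (hn : n < 0) : invQPoch q n = 0 :=
  if_neg hn.not_ge

theorem invQPoch_natCast (q : ℂ) (n : ℕ) : invQPoch q n = (qPoch q q n)⁻¹ := by
  rw [invQPoch, if_pos n.cast_nonneg, Int.toNat_natCast]

theorem invQPoch_sub_one {q : ℂ} (hq : ‖q‖ < 1) (n : ℤ) :
    invQPoch q (n - 1) = (1 - q ^ n) * invQPoch q n := by
  rcases lt_trichotomy n 0 with h | rfl | h
  · rw [invQPoch_of_neg q h, invQPoch_of_neg q (by omega), mul_zero]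
  · rw [invQPoch_of_neg q (by omega), zpow_zero, sub_self, zero_mul]
  · obtain ⟨m, rfl⟩ : ∃ m : ℕ, n = (m + 1 : ℕ) := ⟨(n - 1).toNat, by omega⟩
    have h1 := one_sub_pow_ne_zero hq m.succ_ne_zero
    rw [show ((m + 1 : ℕ) : ℤ) - 1 = m by push_cast; ring, invQPoch_natCast, invQPoch_natCast,
      qPoch_succ, mul_inv, ← pow_succ', zpow_natCast, mul_left_comm, mul_inv_cancel₀ h1, mul_one]

/-- The Gaussian binomial coefficient `[2 N, N + j]_q`, which is zero for `N < |j|`. -/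
def centeredQBinom (q : ℂ) (N : ℕ) (j : ℤ) : ℂ :=
  qPoch q q (2 * N) * (invQPoch q (N - j) * invQPoch q (N + j))

theorem centeredQBinom_zero (q : ℂ) (j : ℤ) : centeredQBinom q 0 j = if j = 0 then 1 else 0 := by
  rcases lt_trichotomy j 0 with h | rfl | h
  · simp [centeredQBinom, invQPoch_of_neg q h, h.ne]
  · simp [centeredQBinom, qPoch, invQPoch]
  · simp [centeredQBinom, invQPoch_of_neg q (neg_neg_of_pos h), h.ne']

/-- Two steps of the `q`-Pascal rule. -/
theorem centeredQBinom_succ {q : ℂ} (hq0 : q ≠ 0) (hq : ‖q‖ < 1) (N : ℕ) (j : ℤ) :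
    centeredQBinom q (N + 1) j = (1 + q ^ (2 * N + 1)) * centeredQBinom q N j +
      q ^ ((N : ℤ) - j + 1) * centeredQBinom q N (j - 1) +
        q ^ ((N : ℤ) + j + 1) * centeredQBinom q N (j + 1) := by
  have e1 := invQPoch_sub_one hq (N - j + 1)
  have e2 := invQPoch_sub_one hq (N - j)
  have e3 := invQPoch_sub_one hq (N + j + 1)
  have e4 := invQPoch_sub_one hq (N + j)
  have h : q ^ (2 * N) = q ^ ((N : ℤ) - j) * q ^ ((N : ℤ) + j) := by
    rw [← zpow_add₀ hq0, ← zpow_natCast]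
    congr 1
    push_cast
    ring
  rw [add_sub_cancel_right] at e1 e3
  simp only [centeredQBinom]
  rw [show ((N + 1 : ℕ) : ℤ) - j = N - j + 1 by push_cast; ring,
    show ((N + 1 : ℕ) : ℤ) + j = N + j + 1 by push_cast; ring,
    show (N : ℤ) - (j - 1) = N - j + 1 by ring, show (N : ℤ) + (j - 1) = N + j - 1 by ring,
    show (N : ℤ) - (j + 1) = N - j - 1 by ring, show (N : ℤ) + (j + 1) = N + j + 1 by ring,
    e2, e4, e1, e3, show 2 * (N + 1) = 2 * N + 1 + 1 by ring, qPoch_succ, qPoch_succ,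
    zpow_add_one₀ hq0, zpow_add_one₀ hq0, pow_succ, h]
  ring

theorem tendsto_invQPoch {q : ℂ} (hq : ‖q‖ < 1) :
    Tendsto (invQPoch q) atTop (𝓝 (qPochInf q q)⁻¹) := by
  rw [← Nat.map_cast_int_atTop, tendsto_map'_iff]
  exact ((tendsto_qPoch q hq).inv₀ (qPochInf_self_ne_zero hq)).congr fun n =>
    (invQPoch_natCast q n).symm

theorem tendsto_centeredQBinom {q : ℂ} (hq : ‖q‖ < 1) (j : ℤ) :
    Tendsto (fun N => centeredQBinom q N j) atTop (𝓝 (qPochInf q q)⁻¹) := by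
  have h1 : Tendsto (fun N : ℕ => qPoch q q (2 * N)) atTop (𝓝 (qPochInf q q)) :=
    (tendsto_qPoch q hq).comp (tendsto_id.const_mul_atTop' two_pos)
  have h2 (k : ℤ) : Tendsto (fun N : ℕ => invQPoch q (N + k)) atTop (𝓝 (qPochInf q q)⁻¹) :=
    (tendsto_invQPoch hq).comp (tendsto_atTop_add_const_right _ k tendsto_natCast_atTop_atTop)
  simpa only [centeredQBinom, mul_inv_cancel_left₀ (qPochInf_self_ne_zero hq),
    ← sub_eq_add_neg] using h1.mul ((h2 (-j)).mul (h2 j))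

theorem exists_norm_centeredQBinom_le {q : ℂ} (hq : ‖q‖ < 1) :
    ∃ C : ℝ, ∀ N j, ‖centeredQBinom q N j‖ ≤ C := by
  obtain ⟨A, hA⟩ := (tendsto_qPoch q hq).norm.bddAbove_range
  obtain ⟨B, hB⟩ :=
    ((tendsto_qPoch q hq).inv₀ (qPochInf_self_ne_zero hq)).norm.bddAbove_range
  have hA' (n : ℕ) : ‖qPoch q q n‖ ≤ A := hA ⟨n, rfl⟩
  have hB' (n : ℕ) : ‖(qPoch q q n)⁻¹‖ ≤ B := hB ⟨n, rfl⟩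
  have hA0 : 0 ≤ A := (norm_nonneg _).trans (hA' 0)
  have hB0 : 0 ≤ B := (norm_nonneg _).trans (hB' 0)
  have hinv (n : ℤ) : ‖invQPoch q n‖ ≤ B := by
    rw [invQPoch]
    split_ifs
    · exact hB' _
    · simpa using hB0
  refine ⟨A * (B * B), fun N j => ?_⟩
  rw [centeredQBinom, norm_mul, norm_mul]
  gcongr
  exacts [hA' _, hinv _, hinv _]

/-- Cauchy's finite form of the Jacobi triple product. The recursion characterises
`t n = (-1) ^ n q ^ (n (n - 1) / 2) a ^ n`. -/
theorem hasSum_centeredQBinom_mul {q a : ℂ} (hq0 : q ≠ 0) (hq : ‖q‖ < 1) (ha : a ≠ 0)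
    {t : ℤ → ℂ} (ht0 : t 0 = 1) (ht : ∀ n, t (n + 1) = -(a * q ^ n) * t n) (N : ℕ) :
    HasSum (fun j => centeredQBinom q N j * t j) (qPoch a q N * qPoch (q / a) q N) := by
  induction N with
  | zero =>
    convert hasSum_single (0 : ℤ) fun j hj => ?_ using 1
    · simp [qPoch, centeredQBinom_zero, ht0]
    · rw [centeredQBinom_zero, if_neg hj, zero_mul]
  | succ N ih =>
    have h1 := (Equiv.subRight (1 : ℤ)).hasSum_iff.2 ih
    have h2 := (Equiv.addRight (1 : ℤ)).hasSum_iff.2 ih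
    convert! ((ih.mul_left (1 + q ^ (2 * N + 1))).add (h1.mul_left (-(a * q ^ N)))).add
      (h2.mul_left (-(q ^ (N + 1) / a))) using 1
    · funext j
      have hj := ht (j - 1)
      have hsub : q ^ ((N : ℤ) - j + 1) * q ^ (j - 1) = q ^ N := by
        rw [← zpow_add₀ hq0, ← zpow_natCast]
        congr 1
        ring
      have hadd : q ^ ((N : ℤ) + j + 1) = q ^ (N + 1) * q ^ j := by
        rw [← zpow_natCast, ← zpow_add₀ hq0]
        congr 1
        push_cast
        ring
      rw [sub_add_cancel] at hj
      simp only [Function.comp_apply, Equiv.subRight_apply, Equiv.coe_addRight]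
      rw [centeredQBinom_succ hq0 hq, ht j, hadd, hj, ← hsub]
      field_simp
      ring
    · rw [qPoch_succ, qPoch_succ]
      field_simp
      ring

theorem jacobi_triple_product {q a : ℂ} (hq0 : q ≠ 0) (hq : ‖q‖ < 1) (ha : a ≠ 0)
    {t : ℤ → ℂ} (ht0 : t 0 = 1) (ht : ∀ n, t (n + 1) = -(a * q ^ n) * t n)
    (hs : Summable fun n => ‖t n‖) :
    ∑' n, t n = qPochInf a q * qPochInf (q / a) q * qPochInf q q := by
  obtain ⟨C, hC⟩ := exists_norm_centeredQBinom_le hq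
  have h1 := tendsto_tsum_of_dominated_convergence (𝓕 := atTop)
    (f := fun (N : ℕ) j => centeredQBinom q N j * t j) (hs.mul_left C)
    (fun j => (tendsto_centeredQBinom hq j).mul_const (t j))
    (Eventually.of_forall fun N j => by
      rw [norm_mul]
      exact mul_le_mul_of_nonneg_right (hC N j) (norm_nonneg _))
  simp only [(hasSum_centeredQBinom_mul hq0 hq ha ht0 ht _).tsum_eq, tsum_mul_left] at h1
  have h2 := tendsto_nhds_unique h1 ((tendsto_qPoch a hq).mul (tendsto_qPoch (q / a) hq))
  rw [← h2, mul_comm, mul_inv_cancel_left₀ (qPochInf_self_ne_zero hq)]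

theorem nome_ne_zero (τ : ℂ) : nome τ ≠ 0 := Complex.exp_ne_zero _

theorem norm_nome_lt_one_iff {τ : ℂ} : ‖nome τ‖ < 1 ↔ 0 < τ.im := by
  have h : (2 * Real.pi * I * τ).re = -(2 * Real.pi * τ.im) := by simp
  rw [nome, Complex.norm_exp, Real.exp_lt_one_iff, h, neg_lt_zero,
    mul_pos_iff_of_pos_left Real.two_pi_pos]

theorem nome_natCast_mul (n : ℕ) (τ : ℂ) : nome (n * τ) = nome τ ^ n := by
  rw [nome, nome, ← Complex.exp_nat_mul]
  congr 1
  ring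

theorem nome_add (τ τ' : ℂ) : nome (τ + τ') = nome τ * nome τ' := by
  rw [nome, mul_add, Complex.exp_add, nome, nome]

theorem nome_neg (τ : ℂ) : nome (-τ) = (nome τ)⁻¹ := by
  rw [nome, mul_neg, Complex.exp_neg, nome]

theorem nome_one_half : nome (1 / 2) = -1 := by
  rw [nome, ← Complex.exp_pi_mul_I]
  congr 1
  ring

theorem nome_half_sq (τ : ℂ) : nome (τ / 2) ^ 2 = nome τ := by
  rw [pow_two, ← nome_add, add_halves]

theorem im_ofNat_mul_pos {τ : ℂ} (hτ : 0 < τ.im) (n : ℕ) [n.AtLeastTwo] :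
    0 < ((OfNat.ofNat n : ℂ) * τ).im := by
  have : (0 : ℝ) < OfNat.ofNat n := Nat.ofNat_pos
  simpa using hτ

theorem qPow_ne_zero (τ : ℂ) (r : ℚ) : qPow τ r ≠ 0 := Complex.exp_ne_zero _

theorem qPow_add (τ : ℂ) (r s : ℚ) : qPow τ (r + s) = qPow τ r * qPow τ s := by
  rw [qPow, qPow, qPow, ← Complex.exp_add]
  congr 1
  push_cast
  ring

theorem qPow_pow (τ : ℂ) (r : ℚ) (n : ℕ) : qPow τ r ^ n = qPow τ (n * r) := by
  rw [qPow, qPow, ← Complex.exp_nat_mul]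
  congr 1
  push_cast
  ring

theorem qPow_natCast (τ : ℂ) (n : ℕ) : qPow τ n = nome τ ^ n := by
  rw [qPow, nome, ← Complex.exp_nat_mul]
  congr 1
  push_cast
  ring

theorem eta_eq_qPow_mul_qPochInf (τ : ℂ) : η τ = qPow τ (1 / 24) * qPochInf (nome τ) (nome τ) := by
  rw [ModularForm.eta, Function.Periodic.qParam, qPow, qPochInf]
  congr 2
  · push_cast
    ring
  · funext n
    rw [ModularForm.eta_q_eq_pow, nome, pow_succ']

theorem eta_pow_three (τ : ℂ) :
    η τ ^ 3 = cexp (Real.pi * I * τ / 4) * qPochInf (nome τ) (nome τ) ^ 3 := by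
  rw [eta_eq_qPow_mul_qPochInf, mul_pow, qPow_pow, qPow]
  congr 2
  push_cast
  ring

theorem jacobiTheta₂_eq_qPochInf (z : ℂ) {τ : ℂ} (hτ : 0 < τ.im) :
    jacobiTheta₂ z τ = qPochInf (-nome (τ / 2 + z)) (nome τ) *
      qPochInf (-nome (τ / 2 - z)) (nome τ) * qPochInf (nome τ) (nome τ) := by
  have ha : -nome (τ / 2 + z) ≠ 0 := neg_ne_zero.2 (nome_ne_zero _)
  have hdiv : nome τ / -nome (τ / 2 + z) = -nome (τ / 2 - z) := by
    rw [div_eq_iff ha, neg_mul_neg, ← nome_add]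
    congr 1
    ring
  rw [← hdiv]
  refine jacobi_triple_product (nome_ne_zero τ) (norm_nome_lt_one_iff.2 hτ) ha ?_ (fun n => ?_)
    ((summable_jacobiTheta₂_term_iff z τ).2 hτ).norm
  · simp [jacobiTheta₂_term]
  · rw [jacobiTheta₂_term, jacobiTheta₂_term, nome, nome, ← Complex.exp_int_mul]
    simp only [neg_mul, neg_neg]
    rw [← Complex.exp_add, ← Complex.exp_add]
    congr 1
    push_cast
    ring

/-! ### Theta functions -/

/-- The general term of the theta function with characteristics `thetaChar`. -/
def thetaCharTerm (σ r s : ℂ) (n : ℤ) : ℂ :=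
  cexp (Real.pi * I * σ * (n + r) ^ 2 + 2 * Real.pi * I * n * s)

/-- The theta function with characteristics `∑ exp (π i σ (n + r) ^ 2 + 2 π i n s)`. The constant
factor `exp (2 π i r s)` of the usual normalisation is left out, so that translating `r` by half
periods produces no phases. -/
def thetaChar (σ r s : ℂ) : ℂ := cexp (Real.pi * I * σ * r ^ 2) * jacobiTheta₂ (σ * r + s) σ

theorem hasSum_thetaCharTerm {σ : ℂ} (hσ : 0 < σ.im) (r s : ℂ) :
    HasSum (thetaCharTerm σ r s) (thetaChar σ r s) := by
  refine ((hasSum_jacobiTheta₂_term (σ * r + s) hσ).mul_left _).congr_fun fun n => ?_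
  rw [thetaCharTerm, jacobiTheta₂_term, ← Complex.exp_add]
  congr 1
  ring

theorem thetaChar_neg_neg (σ r s : ℂ) : thetaChar σ (-r) (-s) = thetaChar σ r s := by
  rw [thetaChar, thetaChar, neg_sq, mul_neg, ← neg_add, jacobiTheta₂_neg_left]

theorem thetaChar_right_add_one (σ r s : ℂ) : thetaChar σ r (s + 1) = thetaChar σ r s := by
  rw [thetaChar, thetaChar, ← add_assoc, jacobiTheta₂_add_left]

theorem thetaChar_left_add_one (σ r s : ℂ) :
    thetaChar σ (r + 1) s = nome (-s) * thetaChar σ r s := by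
  rw [thetaChar, thetaChar, show σ * (r + 1) + s = σ * r + s + σ by ring, jacobiTheta₂_add_left',
    ← mul_assoc, ← mul_assoc, nome, ← Complex.exp_add, ← Complex.exp_add]
  congr 2
  ring

/-- Pairs of integers of even, respectively odd, sum, in terms of half their sum and half their
difference. -/
def sumDiffEquiv : (ℤ × ℤ) ⊕ (ℤ × ℤ) ≃ ℤ × ℤ where
  toFun := Sum.elim (fun p => (p.1 + p.2, p.1 - p.2)) (fun p => (p.1 + p.2 + 1, p.1 - p.2))
  invFun p := if (p.1 + p.2) % 2 = 0 then Sum.inl ((p.1 + p.2) / 2, (p.1 - p.2) / 2)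
    else Sum.inr ((p.1 + p.2) / 2, (p.1 - p.2) / 2)
  left_inv := by
    rintro (⟨m, n⟩ | ⟨m, n⟩)
    · have h : (m + n + (m - n)) % 2 = 0 := by omega
      simp only [Sum.elim_inl, h, if_true, Sum.inl.injEq, Prod.mk.injEq]
      omega
    · have h : ¬ (m + n + 1 + (m - n)) % 2 = 0 := by omega
      simp only [Sum.elim_inr, h, if_false, Sum.inr.injEq, Prod.mk.injEq]
      omega
  right_inv p := by
    obtain ⟨m, n⟩ := p
    dsimp only
    split_ifs with h
    · simp only [Sum.elim_inl, Prod.mk.injEq]; omega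
    · simp only [Sum.elim_inr, Prod.mk.injEq]; omega

theorem hasSum_thetaCharTerm_mul {σ : ℂ} (hσ : 0 < σ.im) (r s r' s' : ℂ) :
    HasSum (fun p : ℤ × ℤ => thetaCharTerm σ r s p.1 * thetaCharTerm σ r' s' p.2)
      (thetaChar σ r s * thetaChar σ r' s') :=
  have h := hasSum_thetaCharTerm hσ r s
  have h' := hasSum_thetaCharTerm hσ r' s'
  h.mul h' (summable_mul_of_summable_norm h.summable.norm h'.summable.norm)

theorem thetaChar_add_mul_thetaChar_sub {σ : ℂ} (hσ : 0 < σ.im) (u v s t : ℂ) :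
    thetaChar σ (u + v) (s + t) * thetaChar σ (u - v) (s - t) =
      thetaChar (2 * σ) u (2 * s) * thetaChar (2 * σ) v (2 * t) +
        nome (s + t) * (thetaChar (2 * σ) (u + 1 / 2) (2 * s) *
          thetaChar (2 * σ) (v + 1 / 2) (2 * t)) := by
  have h2 := im_ofNat_mul_pos hσ 2
  have heven := hasSum_thetaCharTerm_mul h2 u (2 * s) v (2 * t)
  have hodd := (hasSum_thetaCharTerm_mul h2 (u + 1 / 2) (2 * s) (v + 1 / 2) (2 * t)).mul_left
      (nome (s + t))
  refine (sumDiffEquiv.hasSum_iff.2 (hasSum_thetaCharTerm_mul hσ _ _ _ _)).unique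
    (HasSum.sum (heven.congr_fun fun p => ?_) (hodd.congr_fun fun p => ?_))
  · simp only [Function.comp_apply, thetaCharTerm, sumDiffEquiv, Equiv.coe_fn_mk, Sum.elim_inl]
    rw [← Complex.exp_add, ← Complex.exp_add]
    push_cast
    congr 1
    ring
  · simp only [Function.comp_apply, thetaCharTerm, sumDiffEquiv, Equiv.coe_fn_mk, Sum.elim_inr]
    rw [nome, ← Complex.exp_add, ← Complex.exp_add, ← Complex.exp_add]
    push_cast
    congr 1
    ring

/-- Jacobi's theta function `θ₃` of modulus `σ` at `z = π σ u`, multiplied by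
`exp (π i σ u ^ 2)`: this factor turns the quasi-period `π σ` into the (anti)period `u = 1`. -/
def theta₃ (σ u : ℂ) : ℂ := thetaChar σ u 0

/-- Jacobi's theta function `θ₄`, normalised as `theta₃`. -/
def theta₄ (σ u : ℂ) : ℂ := thetaChar σ u (1 / 2)

/-- Jacobi's theta function `θ₂`, normalised as `theta₃`. -/
def theta₂ (σ u : ℂ) : ℂ := theta₃ σ (u + 1 / 2)

/-- Jacobi's odd theta function `θ₁`, up to a constant factor and normalised as `theta₃`. -/
def theta₁ (σ u : ℂ) : ℂ := theta₄ σ (u + 1 / 2)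

theorem theta₃_add_one (σ u : ℂ) : theta₃ σ (u + 1) = theta₃ σ u := by
  rw [theta₃, thetaChar_left_add_one, neg_zero, nome, mul_zero, Complex.exp_zero, one_mul, theta₃]

theorem theta₄_add_one (σ u : ℂ) : theta₄ σ (u + 1) = -theta₄ σ u := by
  rw [theta₄, thetaChar_left_add_one, nome_neg, nome_one_half, inv_neg_one, neg_one_mul, theta₄]

theorem theta₄_neg (σ u : ℂ) : theta₄ σ (-u) = theta₄ σ u := by
  rw [theta₄, ← thetaChar_neg_neg, neg_neg, ← thetaChar_right_add_one, theta₄]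
  norm_num

theorem theta₄_one_sub (σ u : ℂ) : theta₄ σ (1 - u) = -theta₄ σ u := by
  rw [← theta₄_neg, neg_sub, ← neg_eq_iff_eq_neg, ← theta₄_add_one, sub_add_cancel]

theorem theta₁_one_sub (σ u : ℂ) : theta₁ σ (1 - u) = theta₁ σ u := by
  have h := theta₄_one_sub σ (u - 1 / 2)
  rwa [← theta₄_add_one, show 1 - (u - 1 / 2) = 1 - u + 1 / 2 by ring,
    show u - 1 / 2 + 1 = u + 1 / 2 by ring] at h

theorem theta₃_add_mul_theta₃_sub {σ : ℂ} (hσ : 0 < σ.im) (u v : ℂ) :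
    theta₃ σ (u + v) * theta₃ σ (u - v) =
      theta₃ (2 * σ) u * theta₃ (2 * σ) v + theta₂ (2 * σ) u * theta₂ (2 * σ) v := by
  have h := thetaChar_add_mul_thetaChar_sub hσ u v 0 0
  rwa [add_zero, sub_zero, mul_zero, nome, mul_zero, Complex.exp_zero, one_mul] at h

theorem theta₄_add_mul_theta₄_sub {σ : ℂ} (hσ : 0 < σ.im) (u v : ℂ) :
    theta₄ σ (u + v) * theta₄ σ (u - v) =
      theta₃ (2 * σ) u * theta₃ (2 * σ) v - theta₂ (2 * σ) u * theta₂ (2 * σ) v := by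
  have h := thetaChar_add_mul_thetaChar_sub hσ u v (1 / 2) 0
  have hone (r : ℂ) : thetaChar (2 * σ) r (2 * (1 / 2)) = theta₃ (2 * σ) r := by
    rw [mul_one_div_cancel two_ne_zero, ← zero_add (1 : ℂ), thetaChar_right_add_one, theta₃]
  rwa [add_zero, sub_zero, hone, hone, mul_zero, nome_one_half, neg_one_mul, ← sub_eq_add_neg] at h

theorem theta₂_add_one_half (σ u : ℂ) : theta₂ σ (u + 1 / 2) = theta₃ σ u := by
  rw [theta₂, add_assoc, add_halves, theta₃_add_one]

theorem theta₂_add_mul_theta₂_sub {σ : ℂ} (hσ : 0 < σ.im) (u v : ℂ) :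
    theta₂ σ (u + v) * theta₂ σ (u - v) =
      theta₂ (2 * σ) u * theta₃ (2 * σ) v + theta₃ (2 * σ) u * theta₂ (2 * σ) v := by
  rw [theta₂, theta₂, add_right_comm, sub_add_eq_add_sub, theta₃_add_mul_theta₃_sub hσ,
    theta₂_add_one_half, ← theta₂]

theorem theta₁_add_mul_theta₁_sub {σ : ℂ} (hσ : 0 < σ.im) (u v : ℂ) :
    theta₁ σ (u + v) * theta₁ σ (u - v) =
      theta₂ (2 * σ) u * theta₃ (2 * σ) v - theta₃ (2 * σ) u * theta₂ (2 * σ) v := by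
  rw [theta₁, theta₁, add_right_comm, sub_add_eq_add_sub, theta₄_add_mul_theta₄_sub hσ,
    theta₂_add_one_half, ← theta₂]

theorem theta₃_eq_qPochInf {σ : ℂ} (hσ : 0 < σ.im) (u : ℂ) :
    theta₃ σ u = cexp (Real.pi * I * σ * u ^ 2) *
      (qPochInf (-(nome (σ / 2) * nome (σ * u))) (nome σ) *
        qPochInf (-(nome (σ / 2) * (nome (σ * u))⁻¹)) (nome σ) * qPochInf (nome σ) (nome σ)) := by
  rw [theta₃, thetaChar, jacobiTheta₂_eq_qPochInf _ hσ, add_zero, sub_eq_add_neg, nome_add,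
    nome_add, nome_neg]

theorem theta₄_eq_qPochInf {σ : ℂ} (hσ : 0 < σ.im) (u : ℂ) :
    theta₄ σ u = cexp (Real.pi * I * σ * u ^ 2) *
      (qPochInf (nome (σ / 2) * nome (σ * u)) (nome σ) *
        qPochInf (nome (σ / 2) * (nome (σ * u))⁻¹) (nome σ) * qPochInf (nome σ) (nome σ)) := by
  rw [theta₄, thetaChar, jacobiTheta₂_eq_qPochInf _ hσ]
  simp only [sub_eq_add_neg, neg_add, nome_add, nome_neg, nome_one_half, inv_neg, inv_one, mul_neg,
    mul_one, neg_neg]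

theorem nome_half_mul_nome_mul_add_one_half (σ u : ℂ) :
    nome (σ / 2) * nome (σ * (u + 1 / 2)) = nome σ * nome (σ * u) := by
  rw [← nome_add, ← nome_add]
  congr 1
  ring

theorem nome_half_mul_inv_nome_mul_add_one_half (σ u : ℂ) :
    nome (σ / 2) * (nome (σ * (u + 1 / 2)))⁻¹ = (nome (σ * u))⁻¹ := by
  rw [← nome_neg, ← nome_neg, ← nome_add]
  congr 1
  ring

theorem theta₂_eq_qPochInf {σ : ℂ} (hσ : 0 < σ.im) (u : ℂ) :
    theta₂ σ u = cexp (Real.pi * I * σ * (u + 1 / 2) ^ 2) *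
      (qPochInf (-(nome σ * nome (σ * u))) (nome σ) *
        qPochInf (-(nome (σ * u))⁻¹) (nome σ) * qPochInf (nome σ) (nome σ)) := by
  rw [theta₂, theta₃_eq_qPochInf hσ, nome_half_mul_nome_mul_add_one_half,
    nome_half_mul_inv_nome_mul_add_one_half]

theorem theta₁_eq_qPochInf {σ : ℂ} (hσ : 0 < σ.im) (u : ℂ) :
    theta₁ σ u = cexp (Real.pi * I * σ * (u + 1 / 2) ^ 2) *
      (qPochInf (nome σ * nome (σ * u)) (nome σ) *
        qPochInf (nome (σ * u))⁻¹ (nome σ) * qPochInf (nome σ) (nome σ)) := by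
  rw [theta₁, theta₄_eq_qPochInf hσ, nome_half_mul_nome_mul_add_one_half,
    nome_half_mul_inv_nome_mul_add_one_half]

theorem theta₁_mul_theta₂_mul_theta₃_mul_theta₄ {σ : ℂ} (hσ : 0 < σ.im) (u : ℂ) :
    theta₁ σ u * theta₂ σ u * (theta₃ σ u * theta₄ σ u) = η σ ^ 3 * theta₁ σ (2 * u) := by
  have hh : ‖nome (σ / 2)‖ < 1 := norm_nome_lt_one_iff.2 (by simpa using hσ)
  have h1 := qPochInf_sq_eq_mul (nome (σ * u))⁻¹ hh
  have h2 := qPochInf_sq_eq_mul (nome (σ / 2) * nome (σ * u)) hh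
  have hX : nome (σ * (2 * u)) = nome (σ * u) ^ 2 := by
    rw [pow_two, ← nome_add]
    congr 1
    ring
  have hexp : cexp (Real.pi * I * σ * (u + 1 / 2) ^ 2) ^ 2 * cexp (Real.pi * I * σ * u ^ 2) ^ 2 =
      cexp (Real.pi * I * σ / 4) * cexp (Real.pi * I * σ * (2 * u + 1 / 2) ^ 2) := by
    simp only [← Complex.exp_nat_mul, ← Complex.exp_add]
    congr 1
    push_cast
    ring
  have hhX : nome (σ / 2) * nome (σ * u) * nome (σ / 2) = nome σ * nome (σ * u) := by
    rw [mul_right_comm, ← pow_two, nome_half_sq]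
  rw [inv_pow, nome_half_sq, mul_comm _ (nome (σ / 2))] at h1
  rw [mul_pow, nome_half_sq, hhX] at h2
  rw [theta₁_eq_qPochInf hσ, theta₂_eq_qPochInf hσ, theta₃_eq_qPochInf hσ, theta₄_eq_qPochInf hσ,
    theta₁_eq_qPochInf hσ, eta_pow_three, hX]
  linear_combination (norm := (simp only [h1, h2]; ring))
    qPochInf (nome σ) (nome σ) ^ 4 * (qPochInf (nome (σ * u) ^ 2)⁻¹ (nome σ) *
      qPochInf (nome σ * nome (σ * u) ^ 2) (nome σ)) * hexp

theorem theta₂_mul_theta₃_mul_theta₄_zero {σ : ℂ} (hσ : 0 < σ.im) :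
    theta₂ σ 0 * theta₃ σ 0 * theta₄ σ 0 = 2 * η σ ^ 3 := by
  have hq := norm_nome_lt_one_iff.2 hσ
  have hexp : cexp (Real.pi * I * σ * (0 + 1 / 2) ^ 2) = cexp (Real.pi * I * σ / 4) := by
    congr 1
    ring
  have hexp0 : cexp (Real.pi * I * σ * 0 ^ 2) = 1 := by
    rw [zero_pow two_ne_zero, mul_zero, Complex.exp_zero]
  have hone : nome (σ * 0) = 1 := by rw [mul_zero, nome, mul_zero, Complex.exp_zero]
  have hneg : qPochInf (-1) (nome σ) = 2 * qPochInf (-nome σ) (nome σ) := by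
    rw [qPochInf_eq_one_sub_mul _ hq, neg_one_mul]
    norm_num
  have heuler : qPochInf (-nome σ) (nome σ) *
      (qPochInf (nome (σ / 2)) (nome σ) * qPochInf (-nome (σ / 2)) (nome σ)) = 1 := by
    rw [qPochInf_mul_qPochInf_neg _ hq, nome_half_sq, qPochInf_neg_mul_qPochInf_sq hq]
  rw [theta₂_eq_qPochInf hσ, theta₃_eq_qPochInf hσ, theta₄_eq_qPochInf hσ, eta_pow_three, hexp,
    hexp0, hone, inv_one, mul_one, mul_one, hneg]
  linear_combination 2 * cexp (Real.pi * I * σ / 4) * qPochInf (nome σ) (nome σ) ^ 3 *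
    (qPochInf (-nome σ) (nome σ) *
      (qPochInf (nome (σ / 2)) (nome σ) * qPochInf (-nome (σ / 2)) (nome σ)) + 1) * heuler

theorem theta₁_sq {σ : ℂ} (hσ : 0 < σ.im) (u : ℂ) : theta₁ σ u ^ 2 =
    theta₂ (2 * σ) u * theta₃ (2 * σ) 0 - theta₃ (2 * σ) u * theta₂ (2 * σ) 0 := by
  simpa only [add_zero, sub_zero, ← pow_two] using theta₁_add_mul_theta₁_sub hσ u 0

theorem theta₂_sq {σ : ℂ} (hσ : 0 < σ.im) (u : ℂ) : theta₂ σ u ^ 2 =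
    theta₂ (2 * σ) u * theta₃ (2 * σ) 0 + theta₃ (2 * σ) u * theta₂ (2 * σ) 0 := by
  simpa only [add_zero, sub_zero, ← pow_two] using theta₂_add_mul_theta₂_sub hσ u 0

theorem theta₃_sq {σ : ℂ} (hσ : 0 < σ.im) (u : ℂ) : theta₃ σ u ^ 2 =
    theta₃ (2 * σ) u * theta₃ (2 * σ) 0 + theta₂ (2 * σ) u * theta₂ (2 * σ) 0 := by
  simpa only [add_zero, sub_zero, ← pow_two] using theta₃_add_mul_theta₃_sub hσ u 0

theorem theta₄_sq {σ : ℂ} (hσ : 0 < σ.im) (u : ℂ) : theta₄ σ u ^ 2 =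
    theta₃ (2 * σ) u * theta₃ (2 * σ) 0 - theta₂ (2 * σ) u * theta₂ (2 * σ) 0 := by
  simpa only [add_zero, sub_zero, ← pow_two] using theta₄_add_mul_theta₄_sub hσ u 0

/-- The even theta functions `θ₂`, `θ₃`, `θ₄`, which correspond to the three points of order two of
the elliptic curve. -/
def evenTheta : Fin 3 → ℂ → ℂ → ℂ := ![theta₂, theta₃, theta₄]

theorem prod_evenTheta (σ u : ℂ) :
    ∏ i, evenTheta i σ u = theta₂ σ u * theta₃ σ u * theta₄ σ u :=
  Fin.prod_univ_three _

theorem theta₁_add_mul_theta₁_sub_mul_evenTheta_zero_sq {σ : ℂ} (hσ : 0 < σ.im) (i : Fin 3)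
    (u v : ℂ) : theta₁ σ (u + v) * theta₁ σ (u - v) * evenTheta i σ 0 ^ 2 =
      theta₁ σ u ^ 2 * evenTheta i σ v ^ 2 - theta₁ σ v ^ 2 * evenTheta i σ u ^ 2 := by
  rw [theta₁_add_mul_theta₁_sub hσ, theta₁_sq hσ, theta₁_sq hσ]
  fin_cases i
  · change _ * theta₂ σ 0 ^ 2 = _ * theta₂ σ v ^ 2 - _ * theta₂ σ u ^ 2
    simp only [theta₂_sq hσ]
    ring
  · change _ * theta₃ σ 0 ^ 2 = _ * theta₃ σ v ^ 2 - _ * theta₃ σ u ^ 2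
    simp only [theta₃_sq hσ]
    ring
  · change _ * theta₄ σ 0 ^ 2 = _ * theta₄ σ v ^ 2 - _ * theta₄ σ u ^ 2
    simp only [theta₄_sq hσ]
    ring

theorem evenTheta_sq_mul_evenTheta_zero_sq_sub {σ : ℂ} (hσ : 0 < σ.im) {i j k : Fin 3}
    (hij : i < j) (hki : k ≠ i) (hkj : k ≠ j) (u : ℂ) :
    evenTheta i σ u ^ 2 * evenTheta j σ 0 ^ 2 - evenTheta j σ u ^ 2 * evenTheta i σ 0 ^ 2 =
      theta₁ σ u ^ 2 * evenTheta k σ 0 ^ 2 := by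
  obtain ⟨rfl, rfl, rfl⟩ | ⟨rfl, rfl, rfl⟩ | ⟨rfl, rfl, rfl⟩ :
      i = 0 ∧ j = 1 ∧ k = 2 ∨ i = 0 ∧ j = 2 ∧ k = 1 ∨ i = 1 ∧ j = 2 ∧ k = 0 := by
    decide +revert
  all_goals
    simp only [evenTheta, Matrix.cons_val, theta₁_sq hσ, theta₂_sq hσ, theta₃_sq hσ, theta₄_sq hσ]
    ring

theorem prod_evenTheta_zero {σ : ℂ} (hσ : 0 < σ.im) : ∏ i, evenTheta i σ 0 = 2 * η σ ^ 3 := by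
  rw [prod_evenTheta, theta₂_mul_theta₃_mul_theta₄_zero hσ]

theorem theta₁_mul_prod_evenTheta {σ : ℂ} (hσ : 0 < σ.im) (u : ℂ) :
    theta₁ σ u * ∏ i, evenTheta i σ u = η σ ^ 3 * theta₁ σ (2 * u) := by
  rw [prod_evenTheta, ← theta₁_mul_theta₂_mul_theta₃_mul_theta₄ hσ]
  ring

theorem evenTheta_zero_ne_zero {σ : ℂ} (hσ : 0 < σ.im) (i : Fin 3) : evenTheta i σ 0 ≠ 0 := by
  have h : ∏ i, evenTheta i σ 0 ≠ 0 := by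
    rw [prod_evenTheta_zero hσ]
    exact mul_ne_zero two_ne_zero (pow_ne_zero 3 (ModularForm.eta_ne_zero hσ))
  exact Finset.prod_ne_zero_iff.1 h i (Finset.mem_univ i)

/-- The function `℘ - e i` of the complex torus with period ratio `σ`, at `z = π σ u`, where `e i`
is the value of `℘` at a point of order two. It is scaled by the constant, independent of `i`, that
makes the discriminant of the corresponding Weierstrass equation equal to `η σ ^ 24`. -/
def wpSub (σ : ℂ) (i : Fin 3) (u : ℂ) : ℂ :=
  (η σ ^ 3 * evenTheta i σ u / (evenTheta i σ 0 * theta₁ σ u)) ^ 2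

theorem wpSub_sub_wpSub {σ : ℂ} (hσ : 0 < σ.im) (i : Fin 3) {u v : ℂ} (hu : theta₁ σ u ≠ 0)
    (hv : theta₁ σ v ≠ 0) : wpSub σ i v - wpSub σ i u =
      (η σ ^ 3) ^ 2 * (theta₁ σ (u + v) * theta₁ σ (u - v)) /
        (theta₁ σ u ^ 2 * theta₁ σ v ^ 2) := by
  have hi := evenTheta_zero_ne_zero hσ i
  rw [wpSub, wpSub]
  field_simp
  linear_combination -η σ ^ 6 *
    theta₁_add_mul_theta₁_sub_mul_evenTheta_zero_sq hσ i u v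

theorem wpSub_sub_wpSub_index {σ : ℂ} (hσ : 0 < σ.im) {i j k : Fin 3} (hij : i < j) (hki : k ≠ i)
    (hkj : k ≠ j) {u : ℂ} (hu : theta₁ σ u ≠ 0) : wpSub σ i u - wpSub σ j u =
      (η σ ^ 3 * evenTheta k σ 0 / (evenTheta i σ 0 * evenTheta j σ 0)) ^ 2 := by
  have hi := evenTheta_zero_ne_zero hσ i
  have hj := evenTheta_zero_ne_zero hσ j
  rw [wpSub, wpSub]
  field_simp
  linear_combination η σ ^ 6 * evenTheta_sq_mul_evenTheta_zero_sq_sub hσ hij hki hkj u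

theorem prod_wpSub {σ : ℂ} (hσ : 0 < σ.im) {u : ℂ} (hu : theta₁ σ u ≠ 0) :
    4 * ∏ i, wpSub σ i u = ((η σ ^ 3) ^ 3 * theta₁ σ (2 * u) / theta₁ σ u ^ 4) ^ 2 := by
  have hdup : (η σ ^ 3) ^ 3 * theta₁ σ (2 * u) =
      (η σ ^ 3) ^ 2 * (theta₁ σ u * ∏ i, evenTheta i σ u) := by
    rw [theta₁_mul_prod_evenTheta hσ]
    ring
  simp only [wpSub, Finset.prod_pow, Finset.prod_div_distrib, Finset.prod_mul_distrib,
    Finset.prod_const, Finset.card_univ, Fintype.card_fin, prod_evenTheta_zero hσ]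
  rw [hdup]
  field_simp
  ring

theorem sixteen_mul_discr_wpSub {σ : ℂ} (hσ : 0 < σ.im) {u : ℂ} (hu : theta₁ σ u ≠ 0) :
    16 * ((wpSub σ 0 u - wpSub σ 1 u) * (wpSub σ 0 u - wpSub σ 2 u) *
      (wpSub σ 1 u - wpSub σ 2 u)) ^ 2 = (η σ ^ 3) ^ 8 := by
  have hprod := prod_evenTheta_zero hσ
  rw [Fin.prod_univ_three] at hprod
  have hquot : η σ ^ 3 * evenTheta 2 σ 0 / (evenTheta 0 σ 0 * evenTheta 1 σ 0) *
      (η σ ^ 3 * evenTheta 1 σ 0 / (evenTheta 0 σ 0 * evenTheta 2 σ 0)) *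
      (η σ ^ 3 * evenTheta 0 σ 0 / (evenTheta 1 σ 0 * evenTheta 2 σ 0)) = (η σ ^ 3) ^ 2 / 2 :=
    calc
      _ = (η σ ^ 3) ^ 3 / (evenTheta 0 σ 0 * evenTheta 1 σ 0 * evenTheta 2 σ 0) := by
        field_simp
      _ = (η σ ^ 3) ^ 2 / 2 := by
        rw [hprod]
        field_simp
  rw [wpSub_sub_wpSub_index hσ (k := 2) (by decide) (by decide) (by decide) hu,
    wpSub_sub_wpSub_index hσ (k := 1) (by decide) (by decide) (by decide) hu,
    wpSub_sub_wpSub_index hσ (k := 0) (by decide) (by decide) (by decide) hu,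
    ← mul_pow, ← mul_pow, hquot]
  ring

/-! ### The elliptic curve -/

section SepticCurve

open WeierstrassCurve

variable {F : Type*}

/-- The hypotheses say that the points of order two have `X`-coordinates `-r`, `-s` and `-t`. -/
theorem Δ_eq_of_twoTorsion [CommRing F] [IsDomain F] (h2 : (2 : F) ≠ 0) (W : WeierstrassCurve F)
    {r s t : F} (hb₂ : W.b₂ = 4 * (r + s + t)) (hb₄ : W.b₄ = 2 * (r * s + r * t + s * t))
    (hb₆ : W.b₆ = 4 * (r * s * t)) : W.Δ = 16 * ((r - s) * (r - t) * (s - t)) ^ 2 := by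
  have h := W.twoTorsionPolynomial_discr
  rw [Cubic.discr, twoTorsionPolynomial, hb₂, hb₄, hb₆] at h
  refine mul_left_cancel₀ (pow_ne_zero 4 h2) ?_
  linear_combination -h

/-- The elliptic curve with a point of order seven at the origin, in terms of a point of the
conic `x * y - x * z + y * z = 0`; the multiples `P`, `2 P`, `3 P` of the origin `P` have
`X`-coordinates `0`, `- y * z` and `- x * z`. -/
def septicCurve [CommRing F] (x y z : F) : WeierstrassCurve F := ⟨x + y + z, y * z, x * z ^ 2, 0, 0⟩

theorem septicCurve_Δ [CommRing F] {x y z : F} (hconic : x * y - x * z + y * z = 0) :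
    (septicCurve x y z).Δ = x ^ 4 * y ^ 3 * z ^ 3 * (z ^ 2 - x * z - y ^ 2 - 6 * y * z) := by
  simp only [WeierstrassCurve.Δ, b₂, b₄, b₆, b₈, septicCurve]
  linear_combination (-x ^ 5 * z ^ 5 + x ^ 4 * y ^ 2 * z ^ 4 - 3 * x ^ 4 * y * z ^ 5 -
    3 * x ^ 4 * z ^ 6 + x ^ 3 * y ^ 4 * z ^ 3 + 7 * x ^ 3 * y ^ 3 * z ^ 4 - x ^ 3 * y ^ 2 * z ^ 5 -
    15 * x ^ 3 * y * z ^ 6 + 24 * x ^ 3 * z ^ 7 - x ^ 2 * y ^ 4 * z ^ 4 -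
    12 * x ^ 2 * y ^ 3 * z ^ 5 - 38 * x ^ 2 * y ^ 2 * z ^ 6 - 12 * x ^ 2 * y * z ^ 7 -
    x ^ 2 * z ^ 8) * hconic

theorem septicCurve_Δ_eq_of_prod [CommRing F] [IsDomain F] (htwo : (2 : F) ≠ 0) {x y z r s t : F}
    (hx : x ≠ 0) (hy : y ≠ 0) (hz : z ≠ 0) (hconic : x * y - x * z + y * z = 0)
    (h1 : 4 * (r * s * t) = (x * z ^ 2) ^ 2)
    (h2 : 4 * ((r - y * z) * (s - y * z) * (t - y * z)) = (y ^ 2 * z) ^ 2)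
    (h3 : 4 * ((r - x * z) * (s - x * z) * (t - x * z)) = (x ^ 2 * y) ^ 2) :
    (septicCurve x y z).Δ = 16 * ((r - s) * (r - t) * (s - t)) ^ 2 := by
  -- The polynomials `4 (X + r) (X + s) (X + t)` and `4 X ^ 3 + b₂ X ^ 2 + 2 b₄ X + b₆` agree at the
  -- `X`-coordinates of `P`, `2 P` and `3 P`, hence have the same coefficients.
  have hb₂ : (septicCurve x y z).b₂ = (x + y + z) ^ 2 + 4 * (y * z) := rfl
  have hb₄ : (septicCurve x y z).b₄ = (x + y + z) * (x * z ^ 2) := by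
    simp only [b₄, septicCurve, mul_zero, zero_add]
  have hb₆ : (septicCurve x y z).b₆ = (x * z ^ 2) ^ 2 := by
    simp only [b₆, septicCurve, mul_zero, add_zero]
  have hyz : y * z * (4 * (r + s + t) - (septicCurve x y z).b₂) =
      2 * (2 * (r * s + r * t + s * t) - (septicCurve x y z).b₄) := by
    refine mul_left_cancel₀ (mul_ne_zero hy hz) ?_
    rw [hb₂, hb₄]
    linear_combination h2 - h1 - z ^ 2 * (x * y - x * z + y * z + 2 * y ^ 2) * hconic
  have hxz : x * z * (4 * (r + s + t) - (septicCurve x y z).b₂) =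
      2 * (2 * (r * s + r * t + s * t) - (septicCurve x y z).b₄) := by
    refine mul_left_cancel₀ (mul_ne_zero hx hz) ?_
    rw [hb₂, hb₄]
    linear_combination h3 - h1 + x ^ 2 * (x * y + x * z - y * z - 4 * z ^ 2) * hconic
  have hsum : 4 * (r + s + t) - (septicCurve x y z).b₂ = 0 := by
    refine (mul_eq_zero.1 ?_).resolve_left (mul_ne_zero hx hy)
    linear_combination hxz - hyz + (4 * (r + s + t) - (septicCurve x y z).b₂) * hconic
  refine Δ_eq_of_twoTorsion htwo _ (sub_eq_zero.1 hsum).symm ?_ (hb₆.trans h1.symm)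
  refine mul_left_cancel₀ htwo ?_
  linear_combination hyz - y * z * hsum

theorem mul_xyz_eq_of_mul_yz_eq [CommRing F] {x y z t : F} (hconic : x * y - x * z + y * z = 0)
    (ht : t * (y * z) = z ^ 2 - x * z - y ^ 2 - 6 * y * z) :
    t * (x * y * z) = x * (z ^ 2 - y ^ 2 + 6 * x * y - 7 * x * z) := by
  linear_combination x * ht - 6 * x * hconic

theorem sq_mul_xyz_eq_of_mul_yz_eq [CommRing F] [IsDomain F] {x y z t : F} (hy : y ≠ 0)
    (hz : z ≠ 0) (hconic : x * y - x * z + y * z = 0)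
    (ht : t * (y * z) = z ^ 2 - x * z - y ^ 2 - 6 * y * z) :
    t ^ 2 * (x * y * z) = x ^ 3 - 32 * x ^ 2 * y + 13 * x * y ^ 2 - y ^ 3 + 45 * x ^ 2 * z -
      13 * x * z ^ 2 + z ^ 3 := by
  rw [pow_two, mul_assoc, mul_xyz_eq_of_mul_yz_eq hconic ht]
  refine mul_left_cancel₀ (mul_ne_zero hy hz) ?_
  linear_combination x * (z ^ 2 - y ^ 2 + 6 * x * y - 7 * x * z) * ht +
    (-7 * x ^ 2 * z - 6 * x * y ^ 2 - 2 * x * y * z + 8 * x * z ^ 2 + y ^ 3 - z ^ 3) * hconic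

end SepticCurve

/-! ### Values at the points of order seven -/

theorem thetaSeries_eq_theta₄ (k : ℤ) {τ : ℂ} (hτ : 0 < τ.im) :
    thetaSeries k τ = theta₄ (7 * τ) (k / 14) := by
  refine Eq.trans (tsum_congr fun n => ?_)
    (hasSum_thetaCharTerm (im_ofNat_mul_pos hτ 7) (k / 14) (1 / 2)).tsum_eq
  rw [← Complex.exp_pi_mul_I, ← Complex.exp_int_mul, qPow, thetaCharTerm, ← Complex.exp_add]
  congr 1
  push_cast
  ring

theorem theta₁_one_seventh {τ : ℂ} (hτ : 0 < τ.im) : theta₁ (7 * τ) (1 / 7) = thetaA τ := by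
  rw [thetaA, thetaSeries_eq_theta₄ _ hτ, ← theta₄_one_sub, theta₁]
  norm_num

theorem theta₁_two_sevenths {τ : ℂ} (hτ : 0 < τ.im) : theta₁ (7 * τ) (2 / 7) = -thetaB τ := by
  rw [thetaB, thetaSeries_eq_theta₄ _ hτ, ← theta₄_one_sub, theta₁]
  norm_num

theorem theta₁_three_sevenths {τ : ℂ} (hτ : 0 < τ.im) : theta₁ (7 * τ) (3 / 7) = -thetaC τ := by
  rw [thetaC, thetaSeries_eq_theta₄ _ hτ, ← theta₄_one_sub, theta₁]
  norm_num

theorem theta₁_four_sevenths {τ : ℂ} (hτ : 0 < τ.im) : theta₁ (7 * τ) (4 / 7) = -thetaC τ := by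
  rw [← theta₁_three_sevenths hτ, ← theta₁_one_sub]
  norm_num

theorem theta₁_five_sevenths {τ : ℂ} (hτ : 0 < τ.im) : theta₁ (7 * τ) (5 / 7) = -thetaB τ := by
  rw [← theta₁_two_sevenths hτ, ← theta₁_one_sub]
  norm_num

theorem theta₁_six_sevenths {τ : ℂ} (hτ : 0 < τ.im) : theta₁ (7 * τ) (6 / 7) = thetaA τ := by
  rw [← theta₁_one_seventh hτ, ← theta₁_one_sub]
  norm_num

theorem nome_seven_mul (τ : ℂ) : nome (7 * τ) = nome τ ^ 7 := by
  simpa using nome_natCast_mul 7 τ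

theorem eta_seven_mul_pow_three (τ : ℂ) :
    η (7 * τ) ^ 3 = qPow τ (7 / 8) * qPochInf (nome τ ^ 7) (nome τ ^ 7) ^ 3 := by
  rw [eta_pow_three, nome_seven_mul, qPow]
  congr 2
  push_cast
  ring

theorem thetaSeries_eq_qPochInf {τ : ℂ} (hτ : 0 < τ.im) {k : ℤ} {m n : ℕ} (hmn : m + n = 7)
    (hk : k = m - n) : thetaSeries k τ = qPow τ (k ^ 2 / 56) * (qPochInf (nome τ ^ m) (nome τ ^ 7) *
      qPochInf (nome τ ^ n) (nome τ ^ 7) * qPochInf (nome τ ^ 7) (nome τ ^ 7)) := by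
  have hmn' : (m + n : ℂ) = 7 := mod_cast hmn
  have hm : nome (7 * τ / 2) * nome (7 * τ * (k / 14)) = nome τ ^ m := by
    rw [← nome_add, ← nome_natCast_mul, hk]
    congr 1
    push_cast
    linear_combination -τ / 2 * hmn'
  have hn : nome (7 * τ / 2) * (nome (7 * τ * (k / 14)))⁻¹ = nome τ ^ n := by
    rw [← nome_neg, ← nome_add, ← nome_natCast_mul, hk]
    congr 1
    push_cast
    linear_combination -τ / 2 * hmn'
  rw [thetaSeries_eq_theta₄ k hτ, theta₄_eq_qPochInf (im_ofNat_mul_pos hτ 7), hm, hn,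
    nome_seven_mul, qPow]
  congr 2
  push_cast
  ring

theorem thetaA_mul_thetaB_mul_thetaC {τ : ℂ} (hτ : 0 < τ.im) :
    thetaA τ * thetaB τ * thetaC τ = -(qPow τ (5 / 8) * qPochInf (nome τ) (nome τ) *
      qPochInf (nome τ ^ 7) (nome τ ^ 7) ^ 2) := by
  have hexp : qPow τ (5 / 8) = qPow τ ((5 : ℤ) ^ 2 / 56) * qPow τ ((3 : ℤ) ^ 2 / 56) *
      qPow τ ((1 : ℤ) ^ 2 / 56) := by
    rw [← qPow_add, ← qPow_add]
    norm_num
  have hres := qPochInf_eq_prod_residues (nome τ) (norm_nome_lt_one_iff.2 hτ) (m := 7) (by norm_num)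
  simp only [Finset.prod_range_succ, Finset.prod_range_zero, ← pow_succ'] at hres
  rw [thetaA, thetaB, thetaC, thetaSeries_eq_qPochInf hτ (m := 6) (n := 1) rfl (by norm_num),
    thetaSeries_eq_qPochInf hτ (m := 5) (n := 2) rfl (by norm_num),
    thetaSeries_eq_qPochInf hτ (m := 4) (n := 3) rfl (by norm_num), hexp, hres]
  ring

theorem thetaA_mul_thetaB_mul_thetaC_ne_zero {τ : ℂ} (hτ : 0 < τ.im) :
    thetaA τ * thetaB τ * thetaC τ ≠ 0 := by
  have hq := norm_nome_lt_one_iff.2 hτ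
  rw [thetaA_mul_thetaB_mul_thetaC hτ]
  exact neg_ne_zero.2 (mul_ne_zero (mul_ne_zero (qPow_ne_zero _ _) (qPochInf_self_ne_zero hq))
    (pow_ne_zero 2 (qPochInf_self_ne_zero (norm_pow_lt_one hq (by norm_num)))))

theorem thetaA_ne_zero {τ : ℂ} (hτ : 0 < τ.im) : thetaA τ ≠ 0 :=
  left_ne_zero_of_mul (left_ne_zero_of_mul (thetaA_mul_thetaB_mul_thetaC_ne_zero hτ))

theorem thetaB_ne_zero {τ : ℂ} (hτ : 0 < τ.im) : thetaB τ ≠ 0 :=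
  right_ne_zero_of_mul (left_ne_zero_of_mul (thetaA_mul_thetaB_mul_thetaC_ne_zero hτ))

theorem thetaC_ne_zero {τ : ℂ} (hτ : 0 < τ.im) : thetaC τ ≠ 0 :=
  right_ne_zero_of_mul (thetaA_mul_thetaB_mul_thetaC_ne_zero hτ)

theorem x_eq_eta (τ : ℂ) : x τ = η (7 * τ) ^ 3 * thetaB τ / thetaC τ ^ 2 := by
  rw [x, eta_seven_mul_pow_three, mul_div_assoc]

theorem y_eq_eta (τ : ℂ) : y τ = -(η (7 * τ) ^ 3 * thetaA τ / thetaB τ ^ 2) := by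
  rw [y, eta_seven_mul_pow_three, mul_div_assoc, neg_mul, neg_mul]

theorem z_eq_eta (τ : ℂ) : z τ = η (7 * τ) ^ 3 * thetaC τ / thetaA τ ^ 2 := by
  rw [z, eta_seven_mul_pow_three, mul_div_assoc]

theorem eta_seven_mul_pow_three_ne_zero {τ : ℂ} (hτ : 0 < τ.im) : η (7 * τ) ^ 3 ≠ 0 :=
  pow_ne_zero 3 (ModularForm.eta_ne_zero (im_ofNat_mul_pos hτ 7))

theorem x_ne_zero {τ : ℂ} (hτ : 0 < τ.im) : x τ ≠ 0 := by
  rw [x_eq_eta]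
  exact div_ne_zero (mul_ne_zero (eta_seven_mul_pow_three_ne_zero hτ) (thetaB_ne_zero hτ))
    (pow_ne_zero 2 (thetaC_ne_zero hτ))

theorem y_ne_zero {τ : ℂ} (hτ : 0 < τ.im) : y τ ≠ 0 := by
  rw [y_eq_eta]
  exact neg_ne_zero.2 (div_ne_zero
    (mul_ne_zero (eta_seven_mul_pow_three_ne_zero hτ) (thetaA_ne_zero hτ))
    (pow_ne_zero 2 (thetaB_ne_zero hτ)))

theorem z_ne_zero {τ : ℂ} (hτ : 0 < τ.im) : z τ ≠ 0 := by
  rw [z_eq_eta]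
  exact div_ne_zero (mul_ne_zero (eta_seven_mul_pow_three_ne_zero hτ) (thetaC_ne_zero hτ))
    (pow_ne_zero 2 (thetaA_ne_zero hτ))

theorem wpSub_one_seventh_sub_two_sevenths {τ : ℂ} (hτ : 0 < τ.im) (i : Fin 3) :
    wpSub (7 * τ) i (1 / 7) - wpSub (7 * τ) i (2 / 7) = y τ * z τ := by
  have ha := thetaA_ne_zero hτ
  have hb := thetaB_ne_zero hτ
  have h1 := theta₁_one_seventh hτ
  have h2 := theta₁_two_sevenths hτ
  rw [wpSub_sub_wpSub (im_ofNat_mul_pos hτ 7) i (h2 ▸ neg_ne_zero.2 hb) (h1 ▸ ha),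
    show (2 / 7 + 1 / 7 : ℂ) = 3 / 7 by norm_num, show (2 / 7 - 1 / 7 : ℂ) = 1 / 7 by norm_num,
    theta₁_three_sevenths hτ, h1, h2, y_eq_eta, z_eq_eta]
  field_simp

theorem wpSub_one_seventh_sub_three_sevenths {τ : ℂ} (hτ : 0 < τ.im) (i : Fin 3) :
    wpSub (7 * τ) i (1 / 7) - wpSub (7 * τ) i (3 / 7) = x τ * z τ := by
  have ha := thetaA_ne_zero hτ
  have hc := thetaC_ne_zero hτ
  have h1 := theta₁_one_seventh hτ
  have h3 := theta₁_three_sevenths hτ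
  rw [wpSub_sub_wpSub (im_ofNat_mul_pos hτ 7) i (h3 ▸ neg_ne_zero.2 hc) (h1 ▸ ha),
    show (3 / 7 + 1 / 7 : ℂ) = 4 / 7 by norm_num, show (3 / 7 - 1 / 7 : ℂ) = 2 / 7 by norm_num,
    theta₁_four_sevenths hτ, theta₁_two_sevenths hτ, h1, h3, x_eq_eta, z_eq_eta]
  field_simp

theorem wpSub_two_sevenths_sub_three_sevenths {τ : ℂ} (hτ : 0 < τ.im) (i : Fin 3) :
    wpSub (7 * τ) i (2 / 7) - wpSub (7 * τ) i (3 / 7) = x τ * y τ := by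
  have hb := thetaB_ne_zero hτ
  have hc := thetaC_ne_zero hτ
  have h2 := theta₁_two_sevenths hτ
  have h3 := theta₁_three_sevenths hτ
  rw [wpSub_sub_wpSub (im_ofNat_mul_pos hτ 7) i (h3 ▸ neg_ne_zero.2 hc) (h2 ▸ neg_ne_zero.2 hb),
    show (3 / 7 + 2 / 7 : ℂ) = 5 / 7 by norm_num, show (3 / 7 - 2 / 7 : ℂ) = 1 / 7 by norm_num,
    theta₁_five_sevenths hτ, theta₁_one_seventh hτ, h2, h3, x_eq_eta, y_eq_eta]
  field_simp

theorem x_mul_y_sub_x_mul_z_add_y_mul_z {τ : ℂ} (hτ : 0 < τ.im) :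
    x τ * y τ - x τ * z τ + y τ * z τ = 0 := by
  rw [← wpSub_one_seventh_sub_two_sevenths hτ 0, ← wpSub_one_seventh_sub_three_sevenths hτ 0,
    ← wpSub_two_sevenths_sub_three_sevenths hτ 0]
  ring

theorem prod_wpSub_one_seventh {τ : ℂ} (hτ : 0 < τ.im) :
    4 * ∏ i, wpSub (7 * τ) i (1 / 7) = (x τ * z τ ^ 2) ^ 2 := by
  have ha := thetaA_ne_zero hτ
  have hc := thetaC_ne_zero hτ
  have h1 := theta₁_one_seventh hτ
  rw [prod_wpSub (im_ofNat_mul_pos hτ 7) (h1 ▸ ha), show (2 * (1 / 7) : ℂ) = 2 / 7 by norm_num,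
    theta₁_two_sevenths hτ, h1, x_eq_eta, z_eq_eta]
  field_simp

theorem prod_wpSub_two_sevenths {τ : ℂ} (hτ : 0 < τ.im) :
    4 * ∏ i, wpSub (7 * τ) i (2 / 7) = (y τ ^ 2 * z τ) ^ 2 := by
  have ha := thetaA_ne_zero hτ
  have hb := thetaB_ne_zero hτ
  have h2 := theta₁_two_sevenths hτ
  rw [prod_wpSub (im_ofNat_mul_pos hτ 7) (h2 ▸ neg_ne_zero.2 hb),
    show (2 * (2 / 7) : ℂ) = 4 / 7 by norm_num, theta₁_four_sevenths hτ, h2, y_eq_eta, z_eq_eta]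
  field_simp

theorem prod_wpSub_three_sevenths {τ : ℂ} (hτ : 0 < τ.im) :
    4 * ∏ i, wpSub (7 * τ) i (3 / 7) = (x τ ^ 2 * y τ) ^ 2 := by
  have hb := thetaB_ne_zero hτ
  have hc := thetaC_ne_zero hτ
  have h3 := theta₁_three_sevenths hτ
  rw [prod_wpSub (im_ofNat_mul_pos hτ 7) (h3 ▸ neg_ne_zero.2 hc),
    show (2 * (3 / 7) : ℂ) = 6 / 7 by norm_num, theta₁_six_sevenths hτ, h3, x_eq_eta, y_eq_eta]
  field_simp

theorem septicCurve_xyz_Δ {τ : ℂ} (hτ : 0 < τ.im) :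
    (septicCurve (x τ) (y τ) (z τ)).Δ = (η (7 * τ) ^ 3) ^ 8 := by
  have hyz (i : Fin 3) : wpSub (7 * τ) i (2 / 7) = wpSub (7 * τ) i (1 / 7) - y τ * z τ := by
    rw [← wpSub_one_seventh_sub_two_sevenths hτ, sub_sub_cancel]
  have hxz (i : Fin 3) : wpSub (7 * τ) i (3 / 7) = wpSub (7 * τ) i (1 / 7) - x τ * z τ := by
    rw [← wpSub_one_seventh_sub_three_sevenths hτ, sub_sub_cancel]
  have h1 := prod_wpSub_one_seventh hτ
  have h2 := prod_wpSub_two_sevenths hτ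
  have h3 := prod_wpSub_three_sevenths hτ
  simp only [Fin.prod_univ_three, hyz, hxz] at h1 h2 h3
  rw [septicCurve_Δ_eq_of_prod two_ne_zero (x_ne_zero hτ) (y_ne_zero hτ) (z_ne_zero hτ)
    (x_mul_y_sub_x_mul_z_add_y_mul_z hτ) h1 h2 h3]
  exact sixteen_mul_discr_wpSub (im_ofNat_mul_pos hτ 7) (theta₁_one_seventh hτ ▸ thetaA_ne_zero hτ)

theorem x_mul_y_mul_z {τ : ℂ} (hτ : 0 < τ.im) : x τ * y τ * z τ =
    nome τ ^ 2 * (qPochInf (nome τ ^ 7) (nome τ ^ 7) ^ 7 / qPochInf (nome τ) (nome τ)) := by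
  have hq : nome τ ^ 2 * qPow τ (5 / 8) = qPow τ (7 / 8) ^ 3 := by
    rw [qPow_pow, ← qPow_natCast, ← qPow_add]
    norm_num
  have hxyz : x τ * y τ * z τ = -((η (7 * τ) ^ 3) ^ 3 / (thetaA τ * thetaB τ * thetaC τ)) := by
    rw [x_eq_eta, y_eq_eta, z_eq_eta]
    field_simp
  have hs := qPow_ne_zero τ (5 / 8)
  rw [hxyz, thetaA_mul_thetaB_mul_thetaC hτ, eta_seven_mul_pow_three, mul_pow, ← hq]
  field_simp

theorem eta_seven_mul_pow_twenty_four (τ : ℂ) :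
    (η (7 * τ) ^ 3) ^ 8 = nome τ ^ 7 * qPochInf (nome τ ^ 7) (nome τ ^ 7) ^ 24 := by
  have hq : qPow τ (7 / 8) ^ 8 = nome τ ^ 7 := by
    rw [qPow_pow, ← qPow_natCast]
    norm_num
  rw [eta_seven_mul_pow_three, mul_pow, hq, ← pow_mul]

theorem qPochInf_pow_four_div_mul_yz {τ : ℂ} (hτ : 0 < τ.im) :
    qPochInf (nome τ) (nome τ) ^ 4 / (nome τ * qPochInf (nome τ ^ 7) (nome τ ^ 7) ^ 4) *
      (y τ * z τ) = z τ ^ 2 - x τ * z τ - y τ ^ 2 - 6 * y τ * z τ := by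
  have he := qPochInf_self_ne_zero (norm_nome_lt_one_iff.2 hτ)
  have hΔ := septicCurve_Δ (x_mul_y_sub_x_mul_z_add_y_mul_z hτ)
  have hpow : qPochInf (nome τ) (nome τ) ^ 4 / (nome τ * qPochInf (nome τ ^ 7) (nome τ ^ 7) ^ 4) *
      (x τ * y τ * z τ) ^ 4 = nome τ ^ 7 * qPochInf (nome τ ^ 7) (nome τ ^ 7) ^ 24 := by
    rw [x_mul_y_mul_z hτ]
    field_simp
  rw [septicCurve_xyz_Δ hτ, eta_seven_mul_pow_twenty_four] at hΔ
  refine mul_left_cancel₀ (mul_ne_zero (mul_ne_zero (pow_ne_zero 4 (x_ne_zero hτ))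
    (pow_ne_zero 3 (y_ne_zero hτ))) (pow_ne_zero 3 (z_ne_zero hτ))) ?_
  linear_combination hpow + hΔ

end

end Septic

theorem mainTheorem7 (q τ : ℂ) (hq : ‖q‖ < 1) (hτ : q = Septic.nome τ)
    (x y z : ℂ) (hx : x = Septic.x τ) (hy : y = Septic.y τ) (hz : z = Septic.z τ) :
    -- every denominator that occurs is nonzero
    (Septic.thetaA τ ≠ 0 ∧ Septic.thetaB τ ≠ 0 ∧ Septic.thetaC τ ≠ 0 ∧
      Septic.qPochInf q q ≠ 0 ∧ Septic.qPochInf (q ^ 7) (q ^ 7) ≠ 0 ∧ y ≠ 0 ∧ z ≠ 0) ∧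
    -- the four identities
    Septic.qPochInf q q ^ 4 / (q * Septic.qPochInf (q ^ 7) (q ^ 7) ^ 4) =
      (z ^ 2 - x * z - y ^ 2 - 6 * y * z) / (y * z) ∧
    q ^ 2 * (Septic.qPochInf (q ^ 7) (q ^ 7) ^ 7 / Septic.qPochInf q q) = x * y * z ∧
    q * Septic.qPochInf q q ^ 3 * Septic.qPochInf (q ^ 7) (q ^ 7) ^ 3 =
      x * (z ^ 2 - y ^ 2 + 6 * x * y - 7 * x * z) ∧
    Septic.qPochInf q q ^ 7 / Septic.qPochInf (q ^ 7) (q ^ 7) =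
      x ^ 3 - 32 * x ^ 2 * y + 13 * x * y ^ 2 - y ^ 3 + 45 * x ^ 2 * z - 13 * x * z ^ 2
        + z ^ 3 := by
  subst hτ hx hy hz
  have him := Septic.norm_nome_lt_one_iff.1 hq
  have hq0 := Septic.nome_ne_zero τ
  have he := Septic.qPochInf_self_ne_zero hq
  have he' := Septic.qPochInf_self_ne_zero (Septic.norm_pow_lt_one hq (n := 7) (by norm_num))
  have hy := Septic.y_ne_zero him
  have hz := Septic.z_ne_zero him
  have hconic := Septic.x_mul_y_sub_x_mul_z_add_y_mul_z him
  have hxyz := Septic.x_mul_y_mul_z him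
  have hyz := Septic.qPochInf_pow_four_div_mul_yz him
  refine ⟨⟨Septic.thetaA_ne_zero him, Septic.thetaB_ne_zero him, Septic.thetaC_ne_zero him, he, he',
    hy, hz⟩, eq_div_of_mul_eq (mul_ne_zero hy hz) hyz, hxyz.symm, ?_, ?_⟩
  · rw [← Septic.mul_xyz_eq_of_mul_yz_eq hconic hyz, hxyz]
    field_simp
  · rw [← Septic.sq_mul_xyz_eq_of_mul_yz_eq hy hz hconic hyz, hxyz]
    field_simp
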